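/- Theorem 4.1 (Woronowicz). Let $0<q<1$ and let $A_q(SU(2))$ be the universal unital $C^*$-algebra generated by two elements $\alpha,\gamma$ subject to the relations $$\alpha\gamma=q\gamma\alpha,\quad \alpha\gamma^*=q\gamma^*\alpha,\quad \gamma\gamma^*=\gamma^*\gamma,\quad \alpha^*\alpha+\gamma^*\gamma=1=\alpha\alpha^*+q^2\gamma\gamma^*.$$ Let $\Delta\colon A_q(SU(2))\to A_q(SU(2))\otimes A_q(SU(2))$ be the comultiplication, i.e. the unital $*$-homomorphism into the $C^*$-tensor product with $\Delta(\alpha)=\alpha\otimes\alpha-q\,\gamma^*\otimes\gamma$ and $\Delta(\gamma)=\gamma\otimes\alpha+\alpha^*\otimes\gamma$. Let $h$ be the Haar functional, i.e. the bounded linear functional on $A_q(SU(2))$ determined by $h(1)=1$ and $(\mathrm{id}\otimes h)\Delta(a)=h(a)1=(h\otimes\mathrm{id})\Delta(a)$ for all $a\in A_q(SU(2))$. Then $\rho=(\alpha+\alpha^*)/2$ is self-adjoint with spectrum contained in $[-1,1]$, the unital $C^*$-subalgebra generated by $\alpha+\alpha^*$ is $\{p(\rho) : p\in C([-1,1])\}$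 (continuous functional calculus, $p$ complex valued), and for every $p\in C([-1,1])$ $$h\bigl(p((\alpha+\alpha^*)/2)\bigr)=\frac{2}{\pi}\int_{-1}^{1}p(x)\sqrt{1-x^2}\,dx .$$ -/

import Mathlib

open scoped ENNReal

noncomputable section

namespace QuantumSU2

lemma continuous_hom {A B : Type*} [CStarAlgebra A] [CStarAlgebra B] (f : A →⋆ₐ[ℂ] B) :
    Continuous f :=
  AddMonoidHomClass.continuous_of_bound f 1 fun x => by
    simpa using NonUnitalStarAlgHom.norm_apply_le f x

/-! ### The `ℓ^∞`-product of a family of unital C⋆-algebras -/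

section Product

universe u v

instance lpCStarAlgebra {I : Type u} {B : I → Type v} [∀ i, CStarAlgebra (B i)]
    [∀ i, Nontrivial (B i)] : CStarAlgebra (lp B ∞) where

variable {I : Type u} {B : I → Type v} [∀ i, CStarAlgebra (B i)] [∀ i, Nontrivial (B i)]

/-- The `i`-th coordinate, as a unital `⋆`-homomorphism on the `ℓ^∞`-product. -/
def coord (i : I) : lp B ∞ →⋆ₐ[ℂ] B i where
  toFun x := x i
  map_one' := rfl
  map_mul' _ _ := rfl
  map_zero' := rfl
  map_add' _ _ := rfl
  commutes' _ := rfl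
  map_star' _ := rfl

/-- A family of unital `⋆`-homomorphisms, as one into the `ℓ^∞`-product. -/
def prodLift {A : Type*} [CStarAlgebra A] (f : ∀ i, A →⋆ₐ[ℂ] B i) : A →⋆ₐ[ℂ] lp B ∞ where
  toFun x := ⟨fun i => f i x, memℓp_infty ⟨‖x‖, by
    rintro _ ⟨i, rfl⟩
    exact NonUnitalStarAlgHom.norm_apply_le (f i) x⟩⟩
  map_one' := by ext i; simp
  map_mul' x y := by ext i; simp
  map_zero' := by ext i; simp
  map_add' x y := lp.ext (funext fun i => map_add (f i) x y)
  commutes' r := by ext i; exact (f i).commutes' r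
  map_star' x := by ext i; simp [map_star]

end Product

/-! ### The C⋆-algebra `A_q(SU(2))` -/

/-- The defining relations of `A_q(SU(2))` for two elements `a`, `c` of a C⋆-algebra. -/
structure Relations (q : ℝ) {B : Type*} [CStarAlgebra B] (a c : B) : Prop where
  mul_comm : a * c = (q : ℂ) • (c * a)
  mul_star_comm : a * star c = (q : ℂ) • (star c * a)
  normal : c * star c = star c * c
  star_mul_add : star a * a + star c * c = 1
  mul_star_add : a * star a + ((q : ℂ) ^ 2) • (c * star c) = 1

lemma Relations.norm_le {q : ℝ} {B : Type*} [CStarAlgebra B] {a c : B} (h : Relations q a c) :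
    ‖a‖ ≤ 1 ∧ ‖c‖ ≤ 1 := by
  let _ := CStarAlgebra.spectralOrder B
  have _ := CStarAlgebra.spectralOrderedRing B
  have key : ∀ x : B, star x * x ≤ 1 → ‖x‖ ≤ 1 := by
    intro x hx
    have h1 : ‖star x * x‖ ≤ 1 :=
      (CStarAlgebra.norm_le_one_iff_of_nonneg _ (star_mul_self_nonneg x)).2 hx
    rw [CStarRing.norm_star_mul_self] at h1
    nlinarith [norm_nonneg x]
  refine ⟨key a ?_, key c ?_⟩
  · rw [← h.star_mul_add]; exact le_add_of_nonneg_right (star_mul_self_nonneg c)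
  · rw [← h.star_mul_add]; exact le_add_of_nonneg_left (star_mul_self_nonneg a)

lemma Relations.map {q : ℝ} {A B : Type*} [CStarAlgebra A] [CStarAlgebra B] {a c : A}
    (h : Relations q a c) (f : A →⋆ₐ[ℂ] B) : Relations q (f a) (f c) where
  mul_comm := by rw [← map_mul, h.mul_comm, map_smul, map_mul]
  mul_star_comm := by
    rw [← map_star, ← map_mul, h.mul_star_comm, map_smul, map_mul]
  normal := by simpa [map_star] using congrArg f h.normal
  star_mul_add := by simpa [map_star] using congrArg f h.star_mul_add
  mul_star_add := by
    simp only [← map_star, ← map_mul, ← map_smul, ← map_add, h.mul_star_add, map_one]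

/-- A realization of the relations in some (nonzero) unital C⋆-algebra. C⋆-algebras in the
lowest universe suffice: a C⋆-algebra generated by two elements is separable, hence isomorphic
to a C⋆-algebra of operators on a separable Hilbert space. -/
structure Realization (q : ℝ) : Type 1 where
  carrier : Type
  [cstar : CStarAlgebra carrier]
  [nontriv : Nontrivial carrier]
  a : carrier
  c : carrier
  rel : Relations q a c

attribute [instance] Realization.cstar Realization.nontriv

/-- The first generator, in the product over all realizations. -/
def genA (q : ℝ) : lp (fun i : Realization q => i.carrier) ∞ :=
  ⟨fun i => i.a, memℓp_infty ⟨1, by rintro _ ⟨i, rfl⟩; exact i.rel.norm_le.1⟩⟩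

/-- The second generator, in the product over all realizations. -/
def genC (q : ℝ) : lp (fun i : Realization q => i.carrier) ∞ :=
  ⟨fun i => i.c, memℓp_infty ⟨1, by rintro _ ⟨i, rfl⟩; exact i.rel.norm_le.2⟩⟩

/-- The C⋆-subalgebra of the product over all realizations generated by the two generators. -/
def SUqSubalgebra (q : ℝ) : StarSubalgebra ℂ (lp (fun i : Realization q => i.carrier) ∞) :=
  (StarAlgebra.adjoin ℂ {genA q, genC q}).topologicalClosure

/-- `A_q(SU(2))`: the universal unital C⋆-algebra with two generators `α`, `γ` subject to the
relations. The norm of a `⋆`-polynomial in `α`, `γ` is the supremum of its norms over all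
realizations of the relations; see `existsUnique_lift` for the universal property. -/
abbrev SUq (q : ℝ) : Type 1 := SUqSubalgebra q

instance SUq.cstarAlgebra (q : ℝ) : CStarAlgebra (SUq q) :=
  StarSubalgebra.cstarAlgebra (SUqSubalgebra q)
    (h_closed := StarSubalgebra.isClosed_topologicalClosure _)

/-- The generator `α`. -/
def α (q : ℝ) : SUq q :=
  ⟨genA q, StarSubalgebra.le_topologicalClosure _ (StarAlgebra.subset_adjoin ℂ _ (by simp))⟩

/-- The generator `γ`. -/
def γ (q : ℝ) : SUq q :=
  ⟨genC q, StarSubalgebra.le_topologicalClosure _ (StarAlgebra.subset_adjoin ℂ _ (by simp))⟩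

lemma relations (q : ℝ) : Relations q (α q) (γ q) where
  mul_comm := Subtype.ext (lp.ext (funext fun i => i.rel.mul_comm))
  mul_star_comm := Subtype.ext (lp.ext (funext fun i => i.rel.mul_star_comm))
  normal := Subtype.ext (lp.ext (funext fun i => i.rel.normal))
  star_mul_add := Subtype.ext (lp.ext (funext fun i => i.rel.star_mul_add))
  mul_star_add := Subtype.ext (lp.ext (funext fun i => i.rel.mul_star_add))

/-- The unital `⋆`-homomorphism given by a realization: evaluation at its coordinate. -/
def lift {q : ℝ} (i : Realization q) : SUq q →⋆ₐ[ℂ] i.carrier :=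
  (coord i).comp (SUqSubalgebra q).subtype

@[simp] lemma lift_α {q : ℝ} (i : Realization q) : lift i (α q) = i.a := rfl

@[simp] lemma lift_γ {q : ℝ} (i : Realization q) : lift i (γ q) = i.c := rfl

/-- A closed `⋆`-subalgebra of `A_q(SU(2))` that contains `α` and `γ` is everything. -/
lemma eq_top_of_mem {q : ℝ} (S : StarSubalgebra ℂ (SUq q)) (hS : IsClosed (S : Set (SUq q)))
    (ha : α q ∈ S) (hc : γ q ∈ S) : S = ⊤ := by
  have hcl : IsClosed (Subtype.val '' (S : Set (SUq q))) :=
    (StarSubalgebra.isClosed_topologicalClosure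
      (StarAlgebra.adjoin ℂ {genA q, genC q})).isClosedEmbedding_subtypeVal.isClosedMap _ hS
  have hle : SUqSubalgebra q ≤ S.map (SUqSubalgebra q).subtype := by
    refine StarSubalgebra.topologicalClosure_minimal ?_ hcl
    refine StarAlgebra.adjoin_le ?_
    rintro x (rfl | rfl)
    · exact ⟨α q, ha, rfl⟩
    · exact ⟨γ q, hc, rfl⟩
  rw [eq_top_iff]
  rintro x -
  obtain ⟨y, hy, hxy⟩ := hle x.2
  rwa [← Subtype.ext hxy]

/-- The universal property of `A_q(SU(2))`. -/
theorem existsUnique_lift {q : ℝ} {B : Type} [CStarAlgebra B] {a c : B} (h : Relations q a c) :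
    ∃! f : SUq q →⋆ₐ[ℂ] B, f (α q) = a ∧ f (γ q) = c := by
  obtain ⟨f, hf⟩ : ∃ f : SUq q →⋆ₐ[ℂ] B, f (α q) = a ∧ f (γ q) = c := by
    rcases subsingleton_or_nontrivial B with hB | hB
    · exact ⟨{  toFun := fun _ => 0
                map_one' := Subsingleton.elim _ _
                map_mul' := fun _ _ => Subsingleton.elim _ _
                map_zero' := rfl
                map_add' := fun _ _ => Subsingleton.elim _ _
                commutes' := fun _ => Subsingleton.elim _ _
                map_star' := fun _ => Subsingleton.elim _ _ },
        Subsingleton.elim _ _, Subsingleton.elim _ _⟩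
    · exact ⟨lift ⟨B, a, c, h⟩, rfl, rfl⟩
  refine ⟨f, hf, fun g hg => ?_⟩
  have htop := eq_top_of_mem (StarAlgHom.equalizer g f) (isClosed_eq (continuous_hom g) (continuous_hom f))
    (hg.1.trans hf.1.symm) (hg.2.trans hf.2.symm)
  ext x
  exact (htop ▸ StarSubalgebra.mem_top : x ∈ StarAlgHom.equalizer g f)

/-! ### The C⋆-tensor square -/

/-- A pair of unital `⋆`-homomorphisms with commuting ranges from `A` to some (nonzero) unital
C⋆-algebra. -/
structure CommutingPair (A : Type*) [CStarAlgebra A] where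
  carrier : Type
  [cstar : CStarAlgebra carrier]
  [nontriv : Nontrivial carrier]
  fst : A →⋆ₐ[ℂ] carrier
  snd : A →⋆ₐ[ℂ] carrier
  commute : ∀ x y : A, fst x * snd y = snd y * fst x

attribute [instance] CommutingPair.cstar CommutingPair.nontriv

section Tensor

variable (A : Type*) [CStarAlgebra A]

/-- The C⋆-subalgebra, of the product over all commuting pairs, generated by the two copies
of `A`. -/
def tensorSubalgebra : StarSubalgebra ℂ (lp (fun i : CommutingPair A => i.carrier) ∞) :=
  (StarAlgebra.adjoin ℂ
    (Set.range (prodLift fun i : CommutingPair A => i.fst) ∪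
      Set.range (prodLift fun i : CommutingPair A => i.snd))).topologicalClosure

/-- The (maximal) C⋆-tensor product `A ⊗ A` of a separable unital C⋆-algebra with itself: the
norm of `∑ xₖ ⊗ yₖ` is the supremum of `‖∑ f xₖ * g yₖ‖` over all commuting pairs `(f, g)`.
For `A = A_q(SU(2))`, which is of type I, this is the only C⋆-tensor product. -/
abbrev Tensor := tensorSubalgebra A

instance Tensor.cstarAlgebra : CStarAlgebra (Tensor A) :=
  StarSubalgebra.cstarAlgebra (tensorSubalgebra A)
    (h_closed := StarSubalgebra.isClosed_topologicalClosure _)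

variable {A}

/-- The map `x ↦ x ⊗ 1`. -/
def inl : A →⋆ₐ[ℂ] Tensor A :=
  (prodLift fun i : CommutingPair A => i.fst).codRestrict (tensorSubalgebra A) fun x =>
    StarSubalgebra.le_topologicalClosure _ (StarAlgebra.subset_adjoin ℂ _ (Or.inl ⟨x, rfl⟩))

/-- The map `y ↦ 1 ⊗ y`. -/
def inr : A →⋆ₐ[ℂ] Tensor A :=
  (prodLift fun i : CommutingPair A => i.snd).codRestrict (tensorSubalgebra A) fun x =>
    StarSubalgebra.le_topologicalClosure _ (StarAlgebra.subset_adjoin ℂ _ (Or.inr ⟨x, rfl⟩))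

lemma inl_mul_inr (x y : A) : inl x * inr y = inr y * inl x :=
  Subtype.ext (lp.ext (funext fun i => i.commute x y))

/-- The elementary tensor `x ⊗ y`. -/
def tmul (x y : A) : Tensor A := inl x * inr y

/-- `S` is the slice map `id ⊗ h : A ⊗ A → A`, the continuous linear map with
`x ⊗ y ↦ h(y) x`. -/
def IsRightSlice (h : A →L[ℂ] ℂ) (S : Tensor A →L[ℂ] A) : Prop :=
  ∀ x y : A, S (tmul x y) = h y • x

/-- `S` is the slice map `h ⊗ id : A ⊗ A → A`, the continuous linear map with
`x ⊗ y ↦ h(x) y`. -/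
def IsLeftSlice (h : A →L[ℂ] ℂ) (S : Tensor A →L[ℂ] A) : Prop :=
  ∀ x y : A, S (tmul x y) = h x • y

end Tensor

/-! ### The comultiplication -/

/-- If two pairs satisfy the relations and commute with each other, then the entries of the
first column of the product of the two fundamental matrices satisfy the relations. -/
lemma Relations.comul {q : ℝ} {A B : Type*} [CStarAlgebra A] [CStarAlgebra B] {a c : A}
    (h : Relations q a c) (f g : A →⋆ₐ[ℂ] B) (hfg : ∀ x y, f x * g y = g y * f x) :
    Relations q (f a * g a - (q : ℂ) • (f (star c) * g c))
      (f c * g a + f (star a) * g c) := by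
  have key : ∀ x y x' y' : A, f x * g y * (f x' * g y') = f (x * x') * g (y * y') := by
    intro x y x' y'
    rw [map_mul, map_mul, mul_assoc, ← mul_assoc (g y), ← hfg x' y]
    simp only [mul_assoc]
  have e1 := h.mul_comm
  have e2 := h.mul_star_comm
  have e3 : star c * c = c * star c := h.normal.symm
  have e4 : star a * a = 1 - c * star c := by rw [← h.star_mul_add, h.normal]; abel
  have e5 : a * star a = 1 - ((q : ℂ) ^ 2) • (c * star c) := by rw [← h.mul_star_add]; abel
  have e6 : star c * star a = (q : ℂ) • (star a * star c) := by
    simpa using congrArg star e1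
  have e7 : c * star a = (q : ℂ) • (star a * c) := by
    simpa using congrArg star e2
  have s1 : star (f a * g a - (q : ℂ) • (f (star c) * g c)) =
      f (star a) * g (star a) - (q : ℂ) • (f c * g (star c)) := by
    simp only [star_sub, star_smul, star_mul, ← map_star, star_star, Complex.star_def,
      Complex.conj_ofReal, hfg]
  have s2 : star (f c * g a + f (star a) * g c) =
      f (star c) * g (star a) + f a * g (star c) := by
    simp only [star_add, star_mul, ← map_star, star_star, hfg]
  constructor
  all_goals
    try rw [s1]
    try rw [s2]
    simp only [mul_add, add_mul, mul_sub, sub_mul, smul_mul_assoc, mul_smul_comm, key,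
      e1, e2, e3, e4, e5, e6, e7, map_sub, map_smul, map_one, smul_add, smul_sub, one_mul, mul_one]
    try module

/-- The comultiplication `Δ : A_q(SU(2)) → A_q(SU(2)) ⊗ A_q(SU(2))` as a map to the product over
all commuting pairs. -/
def comulAux (q : ℝ) : SUq q →⋆ₐ[ℂ] lp (fun i : CommutingPair (SUq q) => i.carrier) ∞ :=
  prodLift fun i => lift ⟨i.carrier, _, _, (relations q).comul i.fst i.snd i.commute⟩

lemma comulAux_α (q : ℝ) : comulAux q (α q) =
    (tmul (α q) (α q) - (q : ℂ) • tmul (star (γ q)) (γ q) : Tensor (SUq q)) := rfl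

lemma comulAux_γ (q : ℝ) : comulAux q (γ q) =
    (tmul (γ q) (α q) + tmul (star (α q)) (γ q) : Tensor (SUq q)) := rfl

lemma comulAux_mem (q : ℝ) (x : SUq q) : comulAux q x ∈ tensorSubalgebra (SUq q) := by
  have htop := eq_top_of_mem ((tensorSubalgebra (SUq q)).comap (comulAux q))
    ((StarSubalgebra.isClosed_topologicalClosure _).preimage (continuous_hom (comulAux q)))
    (by rw [StarSubalgebra.mem_comap, comulAux_α]; exact Subtype.property _)
    (by rw [StarSubalgebra.mem_comap, comulAux_γ]; exact Subtype.property _)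
  exact (htop ▸ StarSubalgebra.mem_top :
    x ∈ (tensorSubalgebra (SUq q)).comap (comulAux q))

/-- The comultiplication `Δ : A_q(SU(2)) → A_q(SU(2)) ⊗ A_q(SU(2))`, the unital
`⋆`-homomorphism with `Δ(α) = α ⊗ α - q γ⋆ ⊗ γ` and `Δ(γ) = γ ⊗ α + α⋆ ⊗ γ`. -/
def comul (q : ℝ) : SUq q →⋆ₐ[ℂ] Tensor (SUq q) :=
  (comulAux q).codRestrict (tensorSubalgebra (SUq q)) (comulAux_mem q)

lemma comul_α (q : ℝ) :
    comul q (α q) = tmul (α q) (α q) - (q : ℂ) • tmul (star (γ q)) (γ q) :=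
  Subtype.ext (comulAux_α q)

lemma comul_γ (q : ℝ) :
    comul q (γ q) = tmul (γ q) (α q) + tmul (star (α q)) (γ q) :=
  Subtype.ext (comulAux_γ q)

/-! ### The Haar functional -/

/-- `h` is the Haar functional of the quantum group: `h(1) = 1` and
`(id ⊗ h)Δ(a) = h(a)1 = (h ⊗ id)Δ(a)` for all `a`. -/
structure IsHaar (q : ℝ) (h : SUq q →L[ℂ] ℂ) : Prop where
  map_one : h 1 = 1
  right_inv : ∃ S : Tensor (SUq q) →L[ℂ] SUq q, IsRightSlice h S ∧
    ∀ a, S (comul q a) = h a • (1 : SUq q)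
  left_inv : ∃ S : Tensor (SUq q) →L[ℂ] SUq q, IsLeftSlice h S ∧
    ∀ a, S (comul q a) = h a • (1 : SUq q)

/-- The self-adjoint element `(α + α⋆)/2`. -/
def ρ (q : ℝ) : SUq q := (1 / 2 : ℂ) • (α q + star (α q))

end QuantumSU2

end

/-! The compact quantum group SU_q(2) has the same character ring as SU(2), and the distribution of
the fundamental character depends on that ring alone. The entries t_{kj} of the (n+1)-dimensional
corepresentation are the coefficients of x^j y^{n-j} in the image of x^k y^{n-k} under the coaction
on the quantum plane xy = qyx. Its trace χ_n satisfies (α + α⋆) χ_{n+1} = χ_{n+2} + χ_n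
(`mul_character`), which is the recursion of the Chebyshev polynomials of the second kind, so U_n(ρ)
= χ_n (`aeval_chebyshevU`).

The Haar functional kills χ_n for n ≥ 1 (`IsHaar.character_eq_zero`). Invariance turns Δ(t_{kj}) = ∑
t_{ki} ⊗ t_{ij} into ∑ h(t_{ij}) t_{ki} = h(t_{kj}) 1. The circle of one-dimensional representations
α ↦ z, γ ↦ 0 then kills every row except the middle one. If n = 2m > 0, the relation with k = 0, j =
m reduces to h(t_{mm}) t_{0m} = 0, and the representation on ℓ²(ℕ) shows t_{0m} ≠ 0.

The U_n are orthogonal to U_0 = 1 for the semicircle weight, and they span the polynomials. Hence h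
and the integral agree on polynomials in ρ, and by Weierstrass approximation on all continuous
functions. -/

noncomputable section

namespace QuantumSU2

/-! ### Corepresentations on the quantum plane and the recursion for their characters. -/

section MatrixCoefficients

variable {B : Type*} [CStarAlgebra B]

/-- Left multiplication by the first row `a ⊗ x - q c⋆ ⊗ y` of the coaction on the quantum plane
`x y = q y x`, on the coefficients of homogeneous polynomials in the monomials `x ^ j y ^ l`. -/
def mulX (q : ℝ) (a c : B) (f : ℤ → B) : ℤ → B := fun j =>
  a * f (j - 1) - ((q : ℂ) ^ (1 - j)) • (star c * f j)

/-- Left multiplication by the second row `c ⊗ x + a⋆ ⊗ y` of the coaction on the quantum plane. -/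
def mulY (q : ℝ) (a c : B) (f : ℤ → B) : ℤ → B := fun j =>
  c * f (j - 1) + ((q : ℂ) ^ (-j)) • (star a * f j)

/-- The matrix coefficients of the `(k + l + 1)`-dimensional corepresentation: the coefficient of
`x ^ j y ^ (k + l - j)` in the image of `x ^ k y ^ l` under the coaction. -/
def matrixCoeff (q : ℝ) (a c : B) (k l : ℕ) : ℤ → B :=
  (mulX q a c)^[k] ((mulY q a c)^[l] (Pi.single 0 1))

/-- The character of the `(n + 1)`-dimensional corepresentation. -/
def character (q : ℝ) (a c : B) (n : ℕ) : B :=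
  ∑ k ∈ Finset.range (n + 1), matrixCoeff q a c k (n - k) k

variable {q : ℝ} {a c : B}

/-- The coaction respects the relation xy = qyx of the quantum plane. -/
lemma mulX_mulY (hq : q ≠ 0) (h : Relations q a c) (f : ℤ → B) :
    mulX q a c (mulY q a c f) = (q : ℂ) • mulY q a c (mulX q a c f) := by
  have hq' : (q : ℂ) ≠ 0 := by exact_mod_cast hq
  have e1 := h.mul_comm
  have e3 : star c * c = c * star c := h.normal.symm
  have e4 : star a * a = 1 - c * star c := by rw [← h.star_mul_add, h.normal]; abel
  have e5 : a * star a = 1 - ((q : ℂ) ^ 2) • (c * star c) := by rw [← h.mul_star_add]; abel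
  have e6 : star c * star a = (q : ℂ) • (star a * star c) := by
    simpa using congrArg star e1
  funext j
  simp only [mulX, mulY, Pi.smul_apply, mul_add, mul_sub, mul_smul_comm, ← mul_assoc, e1, e3, e4,
    e5, e6, sub_mul, smul_mul_assoc, one_mul, smul_add, smul_sub, smul_smul]
  have z1 : (q : ℂ) ^ (-(j - 1)) = q * (q : ℂ) ^ (-j) := by
    rw [← zpow_one_add₀ hq']; congr 1; ring
  have z2 : (q : ℂ) ^ (1 - j) = q * (q : ℂ) ^ (-j) := by
    rw [← zpow_one_add₀ hq']; congr 1
  have z3 : (q : ℂ) ^ (1 - (j - 1)) = q ^ 2 * (q : ℂ) ^ (-j) := by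
    rw [pow_two, mul_assoc, ← zpow_one_add₀ hq', ← zpow_one_add₀ hq']; congr 1; ring
  simp only [z1, z2, z3]
  module

lemma mulX_smul (r : ℂ) (f : ℤ → B) : mulX q a c (r • f) = r • mulX q a c f := by
  funext j
  simp only [mulX, Pi.smul_apply, mul_smul_comm]
  module

lemma mulX_matrixCoeff (k l : ℕ) :
    mulX q a c (matrixCoeff q a c k l) = matrixCoeff q a c (k + 1) l := by
  simp only [matrixCoeff, Function.iterate_succ_apply']

lemma mulY_matrixCoeff_zero (l : ℕ) :
    mulY q a c (matrixCoeff q a c 0 l) = matrixCoeff q a c 0 (l + 1) := by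
  simp only [matrixCoeff, Function.iterate_succ_apply', Function.iterate_zero, id]

/-- This is x^k y^{l+1} = q^k y x^k y^l, transported by the coaction. -/
lemma matrixCoeff_succ_right (hq : q ≠ 0) (h : Relations q a c) (k l : ℕ) :
    matrixCoeff q a c k (l + 1) = (q : ℂ) ^ k • mulY q a c (matrixCoeff q a c k l) := by
  induction k with
  | zero => simp [mulY_matrixCoeff_zero]
  | succ k ih =>
    rw [← mulX_matrixCoeff, ih, mulX_smul, mulX_mulY hq h, smul_smul, mulX_matrixCoeff, pow_succ]

lemma mulY_matrixCoeff (hq : q ≠ 0) (h : Relations q a c) (k l : ℕ) :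
    mulY q a c (matrixCoeff q a c k l) = (q : ℂ) ^ (-k : ℤ) • matrixCoeff q a c k (l + 1) := by
  have hq' : (q : ℂ) ≠ 0 := by exact_mod_cast hq
  rw [matrixCoeff_succ_right hq h, smul_smul, zpow_neg, zpow_natCast,
    inv_mul_cancel₀ (pow_ne_zero _ hq'), one_smul]

lemma mulX_eq_zero {n : ℤ} {f : ℤ → B} (hf : ∀ j, j < 0 ∨ n < j → f j = 0) (j : ℤ)
    (hj : j < 0 ∨ n + 1 < j) : mulX q a c f j = 0 := by
  rw [mulX, hf (j - 1) (by omega), hf j (by omega)]; simp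

lemma mulY_eq_zero {n : ℤ} {f : ℤ → B} (hf : ∀ j, j < 0 ∨ n < j → f j = 0) (j : ℤ)
    (hj : j < 0 ∨ n + 1 < j) : mulY q a c f j = 0 := by
  rw [mulY, hf (j - 1) (by omega), hf j (by omega)]; simp

lemma matrixCoeff_eq_zero (k l : ℕ) (j : ℤ) (hj : j < 0 ∨ (k + l : ℤ) < j) :
    matrixCoeff q a c k l j = 0 := by
  induction k generalizing j with
  | zero =>
    induction l generalizing j with
    | zero =>
      have : j ≠ 0 := by rintro rfl; simp at hj
      simp [matrixCoeff, this]
    | succ l ih =>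
      rw [← mulY_matrixCoeff_zero]
      exact mulY_eq_zero ih j (by push_cast at hj ⊢; omega)
  | succ k ih =>
    rw [← mulX_matrixCoeff]
    exact mulX_eq_zero ih j (by push_cast at hj ⊢; omega)

/-- Quantum determinant: a (c ⊗ x + a⋆ ⊗ y) - q c (a ⊗ x - q c⋆ ⊗ y) = 1 ⊗ y, because ac = qca and
aa⋆ + q²cc⋆ = 1. The remaining powers of q come from moving y past x^k, and cancel at index k. -/
lemma mul_matrixCoeff_self (hq : q ≠ 0) (h : Relations q a c) (k l : ℕ) :
    a * matrixCoeff q a c k (l + 1) k -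
      (q : ℂ) ^ (k + 1) • (c * matrixCoeff q a c (k + 1) l k) = matrixCoeff q a c k l k := by
  have hq' : (q : ℂ) ≠ 0 := by exact_mod_cast hq
  have e1 := h.mul_comm
  have e5 : a * star a = 1 - ((q : ℂ) ^ 2) • (c * star c) := by rw [← h.mul_star_add]; abel
  rw [matrixCoeff_succ_right hq h, ← mulX_matrixCoeff]
  simp only [mulX, mulY, Pi.smul_apply, mul_add, mul_sub, mul_smul_comm, ← mul_assoc, e1,
    e5, sub_mul, smul_mul_assoc, one_mul, smul_add, smul_sub, smul_smul]
  have z1 : (q : ℂ) ^ (1 - k : ℤ) = q * ((q : ℂ) ^ k)⁻¹ := by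
    rw [← zpow_natCast, ← zpow_neg, ← zpow_one_add₀ hq']; congr 1
  have z2 : (q : ℂ) ^ k ≠ 0 := pow_ne_zero _ hq'
  simp only [z1, zpow_neg, zpow_natCast]
  match_scalars <;> field_simp <;> ring

lemma character_zero : character q a c 0 = 1 := by
  simp [character, matrixCoeff]

lemma character_one : character q a c 1 = a + star a := by
  simp [character, matrixCoeff, Finset.sum_range_succ, mulX, mulY, add_comm]

/-- The Clebsch–Gordan rule for the fundamental corepresentation. The a⋆-terms give the trace of
degree n + 2 without its last diagonal entry, minus terms in c; the top a-term supplies that entry,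
and the other a-terms combine with the c-terms into the trace of degree n by `mul_matrixCoeff_self`.
-/
lemma mul_character (hq : q ≠ 0) (h : Relations q a c) (n : ℕ) :
    (a + star a) * character q a c (n + 1) = character q a c (n + 2) + character q a c n := by
  have hq' : (q : ℂ) ≠ 0 := by exact_mod_cast hq
  have hstar : ∀ k l : ℕ, star a * matrixCoeff q a c k l k = matrixCoeff q a c k (l + 1) k -
      (q : ℂ) ^ k • (c * matrixCoeff q a c k l (k - 1)) := by
    intro k l
    have z2 : (q : ℂ) ^ k ≠ 0 := pow_ne_zero _ hq'
    rw [matrixCoeff_succ_right hq h]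
    simp [mulY, smul_smul, z2]
  have htop : a * matrixCoeff q a c (n + 1) 0 (n + 1 : ℕ) =
      matrixCoeff q a c (n + 2) 0 (n + 2 : ℕ) := by
    rw [← mulX_matrixCoeff (n + 1), mulX,
      matrixCoeff_eq_zero (n + 1) 0 (n + 2 : ℕ) (by push_cast; omega)]
    have : ((n + 2 : ℕ) : ℤ) - 1 = (n + 1 : ℕ) := by push_cast; ring
    rw [this]; simp
  have hS : ∑ k ∈ Finset.range (n + 2), star a * matrixCoeff q a c k (n + 1 - k) k =
      ∑ k ∈ Finset.range (n + 2), matrixCoeff q a c k (n + 2 - k) k -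
      ∑ k ∈ Finset.range (n + 1),
        (q : ℂ) ^ (k + 1) • (c * matrixCoeff q a c (k + 1) (n - k) k) := by
    -- The term k = 0 has column index -1 and drops out, so the c-sum can be shifted by one.
    have h0 : matrixCoeff q a c 0 (n + 1) (-1) = 0 := matrixCoeff_eq_zero _ _ _ (by simp)
    rw [Finset.sum_congr rfl fun k hk => hstar k (n + 1 - k), Finset.sum_sub_distrib]
    congr 1
    · refine Finset.sum_congr rfl fun k hk => ?_
      rw [Finset.mem_range] at hk
      congr 1; omega
    · rw [Finset.sum_range_succ']
      simp [h0]
  have hA : ∑ k ∈ Finset.range (n + 2), a * matrixCoeff q a c k (n + 1 - k) k =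
      matrixCoeff q a c (n + 2) 0 (n + 2 : ℕ) + ∑ k ∈ Finset.range (n + 1),
        a * matrixCoeff q a c k (n - k + 1) k := by
    rw [Finset.sum_range_succ, add_comm, Nat.sub_self, htop]
    congr 1
    refine Finset.sum_congr rfl fun k hk => ?_
    rw [Finset.mem_range] at hk
    congr 2; omega
  have hB : character q a c n = ∑ k ∈ Finset.range (n + 1),
        a * matrixCoeff q a c k (n - k + 1) k - ∑ k ∈ Finset.range (n + 1),
        (q : ℂ) ^ (k + 1) • (c * matrixCoeff q a c (k + 1) (n - k) k) := by
    rw [character, ← Finset.sum_sub_distrib]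
    exact Finset.sum_congr rfl fun k _ => (mul_matrixCoeff_self hq h k (n - k)).symm
  have hC : character q a c (n + 2) = ∑ k ∈ Finset.range (n + 2),
      matrixCoeff q a c k (n + 2 - k) k + matrixCoeff q a c (n + 2) 0 (n + 2 : ℕ) := by
    rw [character, Finset.sum_range_succ, Nat.sub_self]
  rw [hB, hC, character, add_mul, Finset.mul_sum, Finset.mul_sum, hS, hA]
  abel

lemma map_matrixCoeff {A : Type*} [CStarAlgebra A] (f : B →⋆ₐ[ℂ] A) (k l : ℕ) (j : ℤ) :
    f (matrixCoeff q a c k l j) = matrixCoeff q (f a) (f c) k l j := by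
  induction k generalizing j with
  | zero =>
    induction l generalizing j with
    | zero => by_cases hj : j = 0 <;> simp [matrixCoeff, hj]
    | succ l ih =>
      simp only [← mulY_matrixCoeff_zero, mulY, map_add, map_mul, map_smul, map_star, ih]
  | succ k ih =>
    simp only [← mulX_matrixCoeff, mulX, map_sub, map_mul, map_smul, map_star, ih]

end MatrixCoefficients

/-! ### The comultiplication on matrix coefficients. -/

section Comultiplication

variable {q : ℝ}

lemma tmul_mul_tmul {A : Type*} [CStarAlgebra A] (x y x' y' : A) :
    tmul x y * tmul x' y' = tmul (x * x') (y * y') := by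
  simp only [tmul, map_mul, mul_assoc]
  rw [← mul_assoc (inr y), ← inl_mul_inr x' y, mul_assoc]

lemma star_tmul {A : Type*} [CStarAlgebra A] (x y : A) :
    star (tmul x y) = tmul (star x) (star y) := by
  simp only [tmul, star_mul, ← map_star, inl_mul_inr]

lemma comul_star_α (q : ℝ) : comul q (star (α q)) =
    tmul (star (α q)) (star (α q)) - (q : ℂ) • tmul (γ q) (star (γ q)) := by
  simp [map_star, comul_α, star_tmul]

lemma comul_star_γ (q : ℝ) : comul q (star (γ q)) =
    tmul (star (γ q)) (star (α q)) + tmul (α q) (star (γ q)) := by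
  simp [map_star, comul_γ, star_tmul]

/-- `f` lists the coefficients of a row vector which the comultiplication expands along the
rows of the `(n + 1)`-dimensional corepresentation. -/
def IsCorepRow (q : ℝ) (n : ℕ) (f : ℤ → SUq q) : Prop :=
  (∀ j : ℤ, j < 0 ∨ (n : ℤ) < j → f j = 0) ∧ ∀ j, comul q (f j) =
    ∑ i ∈ Finset.range (n + 1), tmul (f i) (matrixCoeff q (α q) (γ q) i (n - i) j)

lemma tmul_add_right {A : Type*} [CStarAlgebra A] (x y z : A) :
    tmul x (y + z) = tmul x y + tmul x z := by simp [tmul, mul_add]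

lemma tmul_add_left {A : Type*} [CStarAlgebra A] (x y z : A) :
    tmul (x + y) z = tmul x z + tmul y z := by simp [tmul, add_mul]

lemma tmul_sub_right {A : Type*} [CStarAlgebra A] (x y z : A) :
    tmul x (y - z) = tmul x y - tmul x z := by simp [tmul, mul_sub]

lemma tmul_sub_left {A : Type*} [CStarAlgebra A] (x y z : A) :
    tmul (x - y) z = tmul x z - tmul y z := by simp [tmul, sub_mul]

lemma tmul_smul {A : Type*} [CStarAlgebra A] (r : ℂ) (x y : A) :
    tmul x (r • y) = r • tmul x y := by simp [tmul]

lemma smul_tmul {A : Type*} [CStarAlgebra A] (r : ℂ) (x y : A) :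
    tmul (r • x) y = r • tmul x y := by simp [tmul]

lemma zero_tmul {A : Type*} [CStarAlgebra A] (y : A) :
    tmul 0 y = 0 := by simp [tmul]

/-- Expanding Δ(α) and Δ(γ⋆) and collecting the second tensor legs gives ∑ αf_i ⊗ X(t_i) - q ∑ γ⋆f_i
⊗ Y(t_i), where X, Y are the operators `mulX`, `mulY` and t_i is the i-th row. Now X(t_i) is row i +
1 in the next degree and Y(t_i) is q^{-i} times row i. -/
lemma IsCorepRow.mulX (hq : q ≠ 0) {n : ℕ} {f : ℤ → SUq q} (hf : IsCorepRow q n f) :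
    IsCorepRow q (n + 1) (mulX q (α q) (γ q) f) := by
  refine ⟨fun j hj => mulX_eq_zero hf.1 j (by push_cast at hj; exact hj), fun j => ?_⟩
  have hq' : (q : ℂ) ≠ 0 := by exact_mod_cast hq
  set T := matrixCoeff q (α q) (γ q) with hT
  -- Reindexing by i + 1 loses only the term with f (-1) = 0; in `e2` the lost term has f (n + 1) =
  -- 0.
  have e1 : ∑ i ∈ Finset.range (n + 2), tmul (α q * f (i - 1)) (T i (n + 1 - i) j) =
      ∑ i ∈ Finset.range (n + 1),
        tmul (α q * f i) (QuantumSU2.mulX q (α q) (γ q) (T i (n - i)) j) := by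
    rw [Finset.sum_range_succ', Nat.cast_zero, hf.1 (0 - 1) (by simp)]
    simp [hT, mulX_matrixCoeff, zero_tmul]
  have e2 : ∑ i ∈ Finset.range (n + 2),
        tmul ((q : ℂ) ^ (1 - i : ℤ) • (star (γ q) * f i)) (T i (n + 1 - i) j) =
      ∑ i ∈ Finset.range (n + 1),
        (q : ℂ) • tmul (star (γ q) * f i) (mulY q (α q) (γ q) (T i (n - i)) j) := by
    rw [Finset.sum_range_succ, hf.1 (n + 1 : ℕ) (by simp)]
    simp only [mul_zero, smul_zero, zero_tmul, add_zero]
    refine Finset.sum_congr rfl fun i hi => ?_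
    rw [Finset.mem_range] at hi
    rw [hT, mulY_matrixCoeff hq (relations q), Pi.smul_apply, tmul_smul, smul_tmul, smul_smul,
      show n - i + 1 = n + 1 - i by omega, ← zpow_one_add₀ hq']
    rfl
  simp only [QuantumSU2.mulX, tmul_sub_left, Finset.sum_sub_distrib] at e1 e2 ⊢
  rw [e1, e2]
  simp only [map_sub, map_smul, map_mul, comul_α, comul_star_γ, hf.2, Finset.mul_sum,
    add_mul, sub_mul, smul_mul_assoc, tmul_mul_tmul, mulY, tmul_add_right, tmul_sub_right,
    tmul_smul, Finset.smul_sum, ← Finset.sum_sub_distrib, smul_add]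
  refine Finset.sum_congr rfl fun i _ => ?_
  have z2 : (q : ℂ) ^ (1 - j) = q * (q : ℂ) ^ (-j) := by
    rw [← zpow_one_add₀ hq']; congr 1
  rw [z2]
  module

lemma IsCorepRow.mulY (hq : q ≠ 0) {n : ℕ} {f : ℤ → SUq q} (hf : IsCorepRow q n f) :
    IsCorepRow q (n + 1) (mulY q (α q) (γ q) f) := by
  refine ⟨fun j hj => mulY_eq_zero hf.1 j (by push_cast at hj; exact hj), fun j => ?_⟩
  have hq' : (q : ℂ) ≠ 0 := by exact_mod_cast hq
  set T := matrixCoeff q (α q) (γ q) with hT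
  have e1 : ∑ i ∈ Finset.range (n + 2), tmul (γ q * f (i - 1)) (T i (n + 1 - i) j) =
      ∑ i ∈ Finset.range (n + 1),
        tmul (γ q * f i) (QuantumSU2.mulX q (α q) (γ q) (T i (n - i)) j) := by
    rw [Finset.sum_range_succ', Nat.cast_zero, hf.1 (0 - 1) (by simp)]
    simp [hT, mulX_matrixCoeff, zero_tmul]
  have e2 : ∑ i ∈ Finset.range (n + 2),
        tmul ((q : ℂ) ^ (-i : ℤ) • (star (α q) * f i)) (T i (n + 1 - i) j) =
      ∑ i ∈ Finset.range (n + 1),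
        tmul (star (α q) * f i) (QuantumSU2.mulY q (α q) (γ q) (T i (n - i)) j) := by
    rw [Finset.sum_range_succ, hf.1 (n + 1 : ℕ) (by simp)]
    simp only [mul_zero, smul_zero, zero_tmul, add_zero]
    refine Finset.sum_congr rfl fun i hi => ?_
    rw [Finset.mem_range] at hi
    rw [hT, mulY_matrixCoeff hq (relations q), Pi.smul_apply, tmul_smul, smul_tmul,
      show n - i + 1 = n + 1 - i by omega]
  simp only [QuantumSU2.mulY, tmul_add_left, Finset.sum_add_distrib] at e1 e2 ⊢
  rw [e1, e2]
  simp only [map_add, map_smul, map_mul, comul_γ, comul_star_α, hf.2, Finset.mul_sum,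
    add_mul, sub_mul, smul_mul_assoc, tmul_mul_tmul, QuantumSU2.mulX, tmul_add_right,
    tmul_sub_right,
    tmul_smul, Finset.smul_sum, ← Finset.sum_add_distrib, smul_sub]
  refine Finset.sum_congr rfl fun i _ => ?_
  have z2 : (q : ℂ) ^ (1 - j) = q * (q : ℂ) ^ (-j) := by
    rw [← zpow_one_add₀ hq']; congr 1
  rw [z2]
  module

lemma isCorepRow_matrixCoeff (hq : q ≠ 0) (k l : ℕ) :
    IsCorepRow q (k + l) (matrixCoeff q (α q) (γ q) k l) := by
  induction k with
  | zero =>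
    induction l with
    | zero =>
      refine ⟨fun j hj => matrixCoeff_eq_zero 0 0 j (by simpa using hj), fun j => ?_⟩
      by_cases hj : j = 0 <;> simp [matrixCoeff, hj, tmul, Pi.single_apply]
    | succ l ih =>
      rw [← mulY_matrixCoeff_zero, ← add_assoc]
      exact ih.mulY hq
  | succ k ih =>
    rw [← mulX_matrixCoeff, add_right_comm]
    exact ih.mulX hq

end Comultiplication

/-! ### One-dimensional representations and the representation on ℓ²(ℕ). -/

section Representations

lemma relations_of_mem_circle (q : ℝ) {z : ℂ} (hz : z * star z = 1) : Relations q z (0 : ℂ) where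
  mul_comm := by simp
  mul_star_comm := by simp
  normal := by simp
  star_mul_add := by simpa [mul_comm] using hz
  mul_star_add := by simpa using hz

/-- Over a point of the circle the coaction is x ↦ zx, y ↦ z̄y, so each monomial is an eigenvector.
-/
lemma matrixCoeff_diagonal (q : ℝ) (z : ℂ) (k l : ℕ) (j : ℤ) :
    matrixCoeff q z 0 k l j = if j = k then z ^ k * star z ^ l else 0 := by
  induction k generalizing j with
  | zero =>
    induction l generalizing j with
    | zero => by_cases hj : j = 0 <;> simp [matrixCoeff, hj]
    | succ l ih =>
      rw [← mulY_matrixCoeff_zero, mulY]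
      by_cases hj : j = 0 <;> simp [ih, hj, pow_succ']
  | succ k ih =>
    rw [← mulX_matrixCoeff, mulX, ih]
    simp only [star_zero, zero_mul, smul_zero, sub_zero, Nat.cast_succ, sub_eq_iff_eq_add]
    split_ifs <;> ring

/-- The Hilbert space `ℓ²(ℕ)`. -/
abbrev Ell2 : Type := lp (fun _ : ℕ => ℂ) 2

/-- The operator `f ↦ (n ↦ w n * f (n + d))` on `ℓ²(ℕ)`. -/
def weightedShift (w : ℕ → ℝ) (hw : ∀ n, |w n| ≤ 1) (d : ℕ) : Ell2 →L[ℂ] Ell2 :=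
  have hp : (0 : ℝ) < (2 : ℝ≥0∞).toReal := by norm_num
  have hle : ∀ (f : Ell2) (n : ℕ),
      ‖(w n : ℂ) * f (n + d)‖ ^ (2 : ℝ≥0∞).toReal ≤ ‖f (n + d)‖ ^ (2 : ℝ≥0∞).toReal := by
    intro f n
    refine Real.rpow_le_rpow (norm_nonneg _) ?_ hp.le
    rw [norm_mul, Complex.norm_real]
    exact mul_le_of_le_one_left (norm_nonneg _) (hw n)
  have hs : ∀ f : Ell2, Summable fun n => ‖f (n + d)‖ ^ (2 : ℝ≥0∞).toReal := fun f =>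
    ((lp.memℓp f).summable hp).comp_injective (add_left_injective d)
  have hsw : ∀ f : Ell2, Summable fun n => ‖(w n : ℂ) * f (n + d)‖ ^ (2 : ℝ≥0∞).toReal := fun f =>
    (hs f).of_nonneg_of_le (fun _ => by positivity) (hle f)
  LinearMap.mkContinuous
    { toFun := fun f => ⟨fun n => w n * f (n + d), memℓp_gen (hsw f)⟩
      map_add' := fun f g => lp.ext (funext fun n => mul_add _ (f (n + d)) (g (n + d)))
      map_smul' := fun r f => by ext n; simp [mul_left_comm] } 1 fun f => by
    rw [one_mul]
    refine lp.norm_le_of_tsum_le hp (norm_nonneg f) ?_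
    rw [lp.norm_rpow_eq_tsum hp f]
    exact ((hsw f).tsum_le_tsum (hle f) (hs f)).trans
      (tsum_comp_le_tsum_of_inj ((lp.memℓp f).summable hp) (fun _ => by positivity)
        (add_left_injective d))

variable {w : ℕ → ℝ} (hw : ∀ n, |w n| ≤ 1)

@[simp] lemma weightedShift_apply (d : ℕ) (f : Ell2) (n : ℕ) :
    weightedShift w hw d f n = w n * f (n + d) := rfl

/-- The standard basis of `ℓ²(ℕ)`. -/
def basisVec (n : ℕ) : Ell2 := lp.single 2 n 1

lemma basisVec_apply (n m : ℕ) : basisVec n m = if m = n then 1 else 0 := by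
  simp [basisVec, lp.single_apply, Pi.single_apply]

lemma inner_basisVec (n : ℕ) (f : Ell2) : inner ℂ (basisVec n) f = f n := by
  simp [basisVec, lp.inner_single_left]

lemma star_apply_eq_inner (T : Ell2 →L[ℂ] Ell2) (f : Ell2) (n : ℕ) :
    star T f n = inner ℂ (T (basisVec n)) f := by
  rw [← inner_basisVec n, ContinuousLinearMap.star_eq_adjoint,
    ContinuousLinearMap.adjoint_inner_right]

@[simp] lemma star_weightedShift_zero_apply (f : Ell2) (n : ℕ) :
    star (weightedShift w hw 0) f n = w n * f n := by
  have : weightedShift w hw 0 (basisVec n) = (w n : ℂ) • basisVec n := by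
    ext m
    rw [lp.coeFn_smul]
    by_cases hm : m = n <;> simp [basisVec_apply, hm, -Complex.coe_smul]
  rw [star_apply_eq_inner, this, inner_smul_left, inner_basisVec, Complex.conj_ofReal]

@[simp] lemma star_weightedShift_one_apply_zero (f : Ell2) :
    star (weightedShift w hw 1) f 0 = 0 := by
  have : weightedShift w hw 1 (basisVec 0) = 0 := by
    ext m
    simp [basisVec_apply]
  rw [star_apply_eq_inner, this, inner_zero_left]

@[simp] lemma star_weightedShift_one_apply_succ (f : Ell2) (n : ℕ) :
    star (weightedShift w hw 1) f (n + 1) = w n * f n := by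
  have : weightedShift w hw 1 (basisVec (n + 1)) = (w n : ℂ) • basisVec n := by
    ext m
    rw [lp.coeFn_smul]
    by_cases hm : m = n <;> simp [basisVec_apply, hm, -Complex.coe_smul]
  rw [star_apply_eq_inner, this, inner_smul_left, inner_basisVec, Complex.conj_ofReal]

lemma abs_qpow_le {q : ℝ} (hq0 : 0 < q) (hq1 : q < 1) (n : ℕ) : |q ^ n| ≤ 1 := by
  rw [abs_of_nonneg (by positivity)]; exact pow_le_one₀ hq0.le hq1.le

lemma abs_sqrt_one_sub_le (q : ℝ) (n : ℕ) : |√(1 - (q ^ (n + 1)) ^ 2)| ≤ 1 := by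
  rw [abs_of_nonneg (Real.sqrt_nonneg _)]
  refine (Real.sqrt_le_sqrt (y := 1) ?_).trans Real.sqrt_one.le
  nlinarith [sq_nonneg (q ^ (n + 1))]

lemma one_sub_qpow_sq_pos {q : ℝ} (hq0 : 0 < q) (hq1 : q < 1) (n : ℕ) :
    0 < 1 - (q ^ (n + 1)) ^ 2 := by
  rw [← pow_mul, sub_pos]
  exact pow_lt_one₀ hq0.le hq1 (by simp)

lemma sqrt_mul_sqrt_qpow {q : ℝ} (hq0 : 0 < q) (hq1 : q < 1) (n : ℕ) :
    (√(1 - (q ^ (n + 1)) ^ 2) : ℂ) * (√(1 - (q ^ (n + 1)) ^ 2) : ℂ) = 1 - (q ^ (n + 1)) ^ 2 := by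
  rw [← Complex.ofReal_mul, Real.mul_self_sqrt (one_sub_qpow_sq_pos hq0 hq1 n).le]
  push_cast; rfl

lemma relations_ell2 {q : ℝ} (hq0 : 0 < q) (hq1 : q < 1) :
    Relations q (weightedShift _ (abs_sqrt_one_sub_le q) 1)
      (weightedShift _ (abs_qpow_le hq0 hq1) 0) where
  mul_comm := by
    ext f n
    simp [lp.coeFn_smul, -Complex.coe_smul]
    ring
  mul_star_comm := by
    ext f n
    simp [lp.coeFn_smul, -Complex.coe_smul]
    ring
  normal := by
    ext f n
    simp
  star_mul_add := by
    ext f n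
    cases n with
    | zero => simp
    | succ n =>
      simp [← mul_assoc, sqrt_mul_sqrt_qpow hq0 hq1]
      ring
  mul_star_add := by
    ext f n
    rw [_root_.add_apply, lp.coeFn_add, Pi.add_apply, _root_.smul_apply, lp.coeFn_smul,
      Pi.smul_apply]
    simp [← mul_assoc, sqrt_mul_sqrt_qpow hq0 hq1]
    ring

/-- Only c, diagonal with positive entries, and a⋆, a raising shift with positive weights, enter
along the row k = 0, and with positive coefficients. Both contributions to an entry are therefore
positive multiples of the same basis vector and cannot cancel. -/
lemma matrixCoeff_ell2_apply {q : ℝ} (hq0 : 0 < q) (hq1 : q < 1) (l j : ℕ) (hj : j ≤ l) :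
    ∃ C : ℝ, 0 < C ∧ matrixCoeff q (weightedShift _ (abs_sqrt_one_sub_le q) 1)
      (weightedShift _ (abs_qpow_le hq0 hq1) 0) 0 l j (basisVec 0) = (C : ℂ) • basisVec (l - j) := by
  have hc : ∀ n, weightedShift _ (abs_qpow_le hq0 hq1) 0 (basisVec n) =
      ((q ^ n : ℝ) : ℂ) • basisVec n := by
    intro n
    ext m
    rw [lp.coeFn_smul]
    by_cases hm : m = n <;> simp [basisVec_apply, hm]
  have ha : ∀ n, star (weightedShift _ (abs_sqrt_one_sub_le q) 1) (basisVec n) =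
      ((√(1 - (q ^ (n + 1)) ^ 2) : ℝ) : ℂ) • basisVec (n + 1) := by
    intro n
    ext m
    rw [lp.coeFn_smul]
    cases m with
    | zero => simp [basisVec_apply]
    | succ m => by_cases hm : m = n <;> simp [basisVec_apply, hm]
  have hpos := one_sub_qpow_sq_pos hq0 hq1
  induction l generalizing j with
  | zero =>
    obtain rfl : j = 0 := by omega
    exact ⟨1, one_pos, by simp [matrixCoeff]⟩
  | succ l ih =>
    have hY : ∀ j ≤ l, ∃ C : ℝ, 0 < C ∧ ((q : ℂ) ^ (-j : ℤ)) •
        star (weightedShift _ (abs_sqrt_one_sub_le q) 1)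
        (matrixCoeff q (weightedShift _ (abs_sqrt_one_sub_le q) 1)
        (weightedShift _ (abs_qpow_le hq0 hq1) 0) 0 l j (basisVec 0)) =
        (C : ℂ) • basisVec (l + 1 - j) := by
      intro j hj
      obtain ⟨C, hC, h⟩ := ih j hj
      refine ⟨q ^ (-j : ℤ) * C * √(1 - (q ^ (l - j + 1)) ^ 2),
        mul_pos (mul_pos (by positivity) hC) (Real.sqrt_pos.2 (hpos _)), ?_⟩
      rw [h, map_smul, ha, smul_smul, smul_smul, show l - j + 1 = l + 1 - j by omega]
      push_cast
      rfl
    have hX : ∀ j ≤ l, ∃ C : ℝ, 0 < C ∧ weightedShift _ (abs_qpow_le hq0 hq1) 0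
        (matrixCoeff q (weightedShift _ (abs_sqrt_one_sub_le q) 1)
        (weightedShift _ (abs_qpow_le hq0 hq1) 0) 0 l j (basisVec 0)) =
        (C : ℂ) • basisVec (l - j) := by
      intro j hj
      obtain ⟨C, hC, h⟩ := ih j hj
      refine ⟨C * q ^ (l - j), by positivity, ?_⟩
      rw [h, map_smul, hc, smul_smul]
      push_cast
      rfl
    rw [← mulY_matrixCoeff_zero]
    simp only [mulY, _root_.add_apply, _root_.smul_apply, mul_apply_eq_comp]
    cases j with
    | zero =>
      obtain ⟨C, hC, h⟩ := hY 0 (by omega)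
      refine ⟨C, hC, ?_⟩
      rw [h, matrixCoeff_eq_zero 0 l ((0 : ℕ) - 1) (by simp)]
      simp
    | succ j =>
      have hj1 : ((j + 1 : ℕ) : ℤ) - 1 = j := by push_cast; ring
      obtain ⟨C, hC, h⟩ := hX j (by omega)
      rw [hj1, h, Nat.add_sub_add_right]
      -- In the top column j = l only the c-term survives.
      rcases Nat.lt_or_ge j l with hlt | hge
      · obtain ⟨D, hD, h'⟩ := hY (j + 1) hlt
        refine ⟨C + D, add_pos hC hD, ?_⟩
        rw [h', Nat.add_sub_add_right, ← add_smul, Complex.ofReal_add]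
      · refine ⟨C, hC, ?_⟩
        rw [matrixCoeff_eq_zero 0 l (j + 1 : ℕ) (by push_cast; omega)]
        simp

lemma matrixCoeff_zero_ne_zero {q : ℝ} (hq0 : 0 < q) (hq1 : q < 1) (l j : ℕ) (hj : j ≤ l) :
    matrixCoeff q (α q) (γ q) 0 l j ≠ 0 := by
  intro h0
  obtain ⟨f, ⟨hf, hf'⟩, -⟩ := existsUnique_lift (relations_ell2 hq0 hq1)
  have h1 := map_matrixCoeff (q := q) f (a := α q) (c := γ q) 0 l j
  obtain ⟨C, hC, h2⟩ := matrixCoeff_ell2_apply hq0 hq1 l j hj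
  rw [h0, map_zero, hf, hf'] at h1
  rw [← h1] at h2
  have h3 := congrArg (fun x : Ell2 => x (l - j)) h2
  simp only [lp.coeFn_smul, Pi.smul_apply, basisVec_apply] at h3
  simp only [if_true, smul_eq_mul, mul_one] at h3
  exact hC.ne (Complex.ofReal_injective h3)

end Representations

/-! ### The Haar functional on matrix coefficients. -/

section Haar

variable {q : ℝ} {h : SUq q →L[ℂ] ℂ}

lemma IsHaar.sum_matrixCoeff (hh : IsHaar q h) (hq : q ≠ 0) (k l : ℕ) (j : ℤ) :
    ∑ i ∈ Finset.range (k + l + 1), h (matrixCoeff q (α q) (γ q) i (k + l - i) j) •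
      matrixCoeff q (α q) (γ q) k l i = h (matrixCoeff q (α q) (γ q) k l j) • (1 : SUq q) := by
  obtain ⟨S, hS, hinv⟩ := hh.right_inv
  rw [← hinv, (isCorepRow_matrixCoeff hq k l).2, map_sum]
  exact Finset.sum_congr rfl fun i _ => (hS _ _).symm

/-- Applying α ↦ z, γ ↦ 0 to `IsHaar.sum_matrixCoeff` leaves h(t_{kj}) z^k z̄^l = h(t_{kj}). -/
lemma IsHaar.matrixCoeff_eq_zero (hh : IsHaar q h) (hq : q ≠ 0) (k l : ℕ) (hkl : k ≠ l) (j : ℤ) :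
    h (matrixCoeff q (α q) (γ q) k l j) = 0 := by
  obtain ⟨z, hz, hzk⟩ : ∃ z : ℂ, z * star z = 1 ∧ z ^ k * star z ^ l ≠ 1 := by
    have hd : (k - l : ℂ) ≠ 0 := sub_ne_zero.2 (by exact_mod_cast hkl)
    have hstar : star (Complex.exp (Real.pi * Complex.I / (k - l))) =
        Complex.exp (-(Real.pi * Complex.I / (k - l))) := by
      rw [Complex.star_def, ← Complex.exp_conj]
      congr 1
      simp [neg_div]
    -- Chosen so that z^k z̄^l = exp(πi) = -1.
    refine ⟨Complex.exp (Real.pi * Complex.I / (k - l)), ?_, ?_⟩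
    · rw [hstar, ← Complex.exp_add]; simp
    · rw [hstar, ← Complex.exp_nat_mul, ← Complex.exp_nat_mul, ← Complex.exp_add,
        show (k : ℂ) * (Real.pi * Complex.I / (k - l)) + l * -(Real.pi * Complex.I / (k - l)) =
          Real.pi * Complex.I by field_simp; ring, Complex.exp_pi_mul_I]
      norm_num
  obtain ⟨f, ⟨hf, hf'⟩, -⟩ := existsUnique_lift (relations_of_mem_circle q hz)
  have key := congrArg f (hh.sum_matrixCoeff hq k l j)
  simp only [map_sum, map_smul, map_matrixCoeff, hf, hf', matrixCoeff_diagonal, _root_.map_one] at key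
  rw [Finset.sum_eq_single_of_mem k (by simp) (fun i _ hi => by simp [hi])] at key
  simp only [if_true, Nat.add_sub_cancel_left, smul_eq_mul, mul_one] at key
  by_contra hne
  exact hzk (mul_left_cancel₀ hne (key.trans (mul_one _).symm))

/-- In the invariance relation for t_{0m} in degree 2m, all rows but the middle one vanish under h,
leaving h(t_{mm}) t_{0m} = 0. -/
lemma IsHaar.matrixCoeff_self_eq_zero (hh : IsHaar q h) (hq0 : 0 < q) (hq1 : q < 1) (m : ℕ)
    (hm : m ≠ 0) : h (matrixCoeff q (α q) (γ q) m m m) = 0 := by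
  have key := hh.sum_matrixCoeff hq0.ne' 0 (m + m) m
  rw [hh.matrixCoeff_eq_zero hq0.ne' 0 (m + m) (by omega), zero_smul,
    Finset.sum_eq_single_of_mem m (by simp) (fun i hi him => ?_), zero_add,
    Nat.add_sub_cancel] at key
  · exact (smul_eq_zero.1 key).resolve_right
      (matrixCoeff_zero_ne_zero hq0 hq1 (m + m) m (by omega))
  · rw [Finset.mem_range] at hi
    rw [hh.matrixCoeff_eq_zero hq0.ne' _ _ (by omega), zero_smul]

theorem IsHaar.character_eq_zero (hh : IsHaar q h) (hq0 : 0 < q) (hq1 : q < 1) (n : ℕ)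
    (hn : n ≠ 0) : h (character q (α q) (γ q) n) = 0 := by
  rw [character, map_sum]
  refine Finset.sum_eq_zero fun k hk => ?_
  rw [Finset.mem_range] at hk
  by_cases hkn : k = n - k
  · rw [← hkn]
    exact hh.matrixCoeff_self_eq_zero hq0 hq1 k (by omega)
  · exact hh.matrixCoeff_eq_zero hq0.ne' k (n - k) hkn k

end Haar

open Polynomial

/-! ### Chebyshev polynomials and the semicircle weight. -/

section Semicircle

lemma span_chebyshevU_eq_top :
    Submodule.span ℝ (Set.range fun n : ℕ => Chebyshev.U ℝ n) = ⊤ := by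
  set V := Submodule.span ℝ (Set.range fun n : ℕ => Chebyshev.U ℝ n) with hV
  have hmem : ∀ n : ℕ, Chebyshev.U ℝ n ∈ V := fun n => Submodule.subset_span ⟨n, rfl⟩
  have hX : ∀ P ∈ V, X * P ∈ V := by
    intro P hP
    induction hP using Submodule.span_induction with
    | mem x hx =>
      obtain ⟨n, rfl⟩ := hx
      have h2 : X * Chebyshev.U ℝ n = (1 / 2 : ℝ) • (2 * X * Chebyshev.U ℝ n) := by
        rw [smul_eq_C_mul, mul_assoc, ← mul_assoc, ← C_ofNat, ← C_mul]
        norm_num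
      show X * Chebyshev.U ℝ n ∈ V
      rw [h2]
      refine V.smul_mem _ ?_
      cases n with
      | zero =>
        have := hmem 1
        simpa using this
      | succ n =>
        have h3 := Chebyshev.U_add_two ℝ n
        have h4 := V.add_mem (hmem (n + 2)) (hmem n)
        push_cast at h4 ⊢
        rwa [h3, sub_add_cancel] at h4
    | zero => simp
    | add x y _ _ hx hy => rw [mul_add]; exact V.add_mem hx hy
    | smul r x _ hx => rw [mul_smul_comm]; exact V.smul_mem r hx
  have hpow : ∀ n : ℕ, (X : ℝ[X]) ^ n ∈ V := by
    intro n
    induction n with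
    | zero => simpa using hmem 0
    | succ n ih => rw [pow_succ']; exact hX _ ih
  rw [eq_top_iff]
  rintro P -
  rw [P.as_sum_range_C_mul_X_pow]
  exact V.sum_mem fun i _ => by rw [← smul_eq_C_mul]; exact V.smul_mem _ (hpow i)

lemma integral_cos_nat_mul {n : ℕ} (hn : n ≠ 0) :
    ∫ θ in (0 : ℝ)..Real.pi, Real.cos (n * θ) = 0 := by
  have hn' : (n : ℝ) ≠ 0 := by exact_mod_cast hn
  rw [intervalIntegral.integral_comp_mul_left (fun x => Real.cos x) hn', integral_cos]
  simp [Real.sin_nat_mul_pi]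

lemma integral_eq_integral_cos {f : ℝ → ℝ} (hf : Continuous f) :
    ∫ x in (-1 : ℝ)..1, f x * √(1 - x ^ 2) =
      ∫ θ in (0 : ℝ)..Real.pi, f (Real.cos θ) * Real.sin θ * Real.sin θ := by
  have h := intervalIntegral.integral_comp_mul_deriv (a := 0) (b := Real.pi)
    (f := Real.cos) (f' := fun θ => -Real.sin θ) (g := fun x => f x * √(1 - x ^ 2))
    (fun θ _ => Real.hasDerivAt_cos θ) (by fun_prop) (by fun_prop)
  rw [Real.cos_zero, Real.cos_pi, intervalIntegral.integral_symm (-1) 1] at h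
  rw [← neg_inj, ← h, ← intervalIntegral.integral_neg]
  refine intervalIntegral.integral_congr fun θ hθ => ?_
  rw [Set.uIcc_of_le Real.pi_pos.le] at hθ
  have : √(1 - Real.cos θ ^ 2) = Real.sin θ := by
    rw [← Real.sin_sq, Real.sqrt_sq (Real.sin_nonneg_of_mem_Icc hθ)]
  simp only [Function.comp_apply, this]
  ring

lemma integral_chebyshevU (n : ℕ) :
    ∫ x in (-1 : ℝ)..1, (Chebyshev.U ℝ n).eval x * √(1 - x ^ 2) =
      if n = 0 then Real.pi / 2 else 0 := by
  rw [integral_eq_integral_cos (Polynomial.continuous _)]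
  -- U_n(cos θ) sin θ = sin((n+1)θ), and the product with sin θ becomes a difference of cosines.
  have h1 : ∀ θ : ℝ, (Chebyshev.U ℝ n).eval (Real.cos θ) * Real.sin θ * Real.sin θ =
      (1 / 2) * (Real.cos (n * θ) - Real.cos ((n + 2 : ℕ) * θ)) := by
    intro θ
    rw [Chebyshev.U_real_cos, Real.cos_sub_cos]
    push_cast
    rw [show ((n * θ + (n + 2) * θ) / 2 : ℝ) = (n + 1) * θ by ring,
      show ((n * θ - (n + 2) * θ) / 2 : ℝ) = -θ by ring, Real.sin_neg]
    ring
  simp only [h1]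
  rw [intervalIntegral.integral_const_mul, intervalIntegral.integral_sub
    (Continuous.intervalIntegrable (by fun_prop) _ _)
    (Continuous.intervalIntegrable (by fun_prop) _ _), integral_cos_nat_mul (Nat.succ_ne_zero _)]
  split_ifs with hn
  · subst hn; simp; ring
  · rw [integral_cos_nat_mul hn]; simp

end Semicircle

/-! ### From polynomials in ρ to the continuous functional calculus. -/

section Moments

variable {q : ℝ}

lemma isSelfAdjoint_ρ (q : ℝ) : IsSelfAdjoint (ρ q) := by
  rw [isSelfAdjoint_iff, ρ, star_smul, star_add, star_star, add_comm]
  simp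

lemma norm_ρ_le (q : ℝ) : ‖ρ q‖ ≤ 1 := by
  have h1 := (relations q).norm_le.1
  rw [ρ, norm_smul]
  have h2 := norm_add_le (α q) (star (α q))
  rw [norm_star] at h2
  have h3 : ‖(1 / 2 : ℂ)‖ = 1 / 2 := by norm_num
  rw [h3]
  linarith

lemma nontrivial_SUq (q : ℝ) : Nontrivial (SUq q) := by
  obtain ⟨f, -, -⟩ := existsUnique_lift (relations_of_mem_circle q (z := 1) (by simp))
  exact f.toAlgHom.toRingHom.domain_nontrivial

lemma spectrum_ρ_subset (q : ℝ) : spectrum ℝ (ρ q) ⊆ Set.Icc (-1) 1 := by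
  have := nontrivial_SUq q
  intro x hx
  exact abs_le.1 ((spectrum.norm_le_norm_of_mem hx).trans (norm_ρ_le q))

lemma exists_ofReal_of_mem_spectrum_ρ {z : ℂ} (hz : z ∈ spectrum ℂ (ρ q)) :
    z.re ∈ Set.Icc (-1 : ℝ) 1 ∧ z = z.re := by
  have h1 := (isSelfAdjoint_ρ q).mem_spectrum_eq_re hz
  refine ⟨spectrum_ρ_subset q ?_, h1⟩
  rw [h1] at hz
  exact spectrum.algebraMap_mem_iff ℂ |>.1 hz

lemma continuousOn_comp_re {p : ℝ → ℂ} (hp : ContinuousOn p (Set.Icc (-1) 1)) :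
    ContinuousOn (fun z : ℂ => p z.re) (spectrum ℂ (ρ q)) :=
  hp.comp Complex.continuous_re.continuousOn fun _ hz => (exists_ofReal_of_mem_spectrum_ρ hz).1

/-- The spectrum is real, so precomposing with the real part changes nothing there. -/
lemma cfc_eval_re (P : ℝ[X]) :
    cfc (fun z : ℂ => ((P.eval z.re : ℝ) : ℂ)) (ρ q) = aeval (ρ q) P := by
  have := (isSelfAdjoint_ρ q).isStarNormal
  rw [← aeval_map_algebraMap ℂ, ← cfc_polynomial (P.map (algebraMap ℝ ℂ)) (ρ q)]
  refine cfc_congr fun z hz => ?_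
  rw [(exists_ofReal_of_mem_spectrum_ρ hz).2, Complex.ofReal_re, eval_map_algebraMap]
  exact (aeval_algebraMap_apply_eq_algebraMap_eval z.re P).symm

lemma aeval_chebyshevU (hq0 : 0 < q) (n : ℕ) :
    aeval (ρ q) (Chebyshev.U ℝ n) = character q (α q) (γ q) n := by
  have hρ : (2 : SUq q) * ρ q = α q + star (α q) := by
    rw [ρ, two_mul, ← add_smul]
    norm_num
  induction n using Nat.twoStepInduction with
  | zero => simp [character_zero]
  | one => rw [Nat.cast_one, Chebyshev.U_one, map_mul, aeval_X, map_ofNat, hρ, character_one]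
  | more n ih1 ih2 =>
    push_cast at ih2 ⊢
    rw [Chebyshev.U_add_two, map_sub, map_mul, map_mul, aeval_X, ih1, ih2,
      eq_sub_of_add_eq (mul_character hq0.ne' (relations q) n).symm, ← hρ, map_ofNat]

variable {h : SUq q →L[ℂ] ℂ}

theorem IsHaar.apply_aeval_ρ (hh : IsHaar q h) (hq0 : 0 < q) (hq1 : q < 1) (P : ℝ[X]) :
    h (aeval (ρ q) P) =
      ((2 / Real.pi * ∫ x in (-1 : ℝ)..1, P.eval x * √(1 - x ^ 2) : ℝ) : ℂ) := by
  have hP : P ∈ Submodule.span ℝ (Set.range fun n : ℕ => Chebyshev.U ℝ n) := by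
    rw [span_chebyshevU_eq_top]; trivial
  have hint : ∀ P : ℝ[X], IntervalIntegrable (fun x => P.eval x * √(1 - x ^ 2))
      MeasureTheory.volume (-1) 1 := fun P => Continuous.intervalIntegrable (by fun_prop) _ _
  induction hP using Submodule.span_induction with
  | mem x hx =>
    obtain ⟨n, rfl⟩ := hx
    dsimp only
    rw [aeval_chebyshevU hq0, integral_chebyshevU]
    split_ifs with hn
    · subst hn
      rw [character_zero, hh.map_one]
      have := Real.pi_ne_zero
      field_simp
      simp
    · rw [hh.character_eq_zero hq0 hq1 n hn]; simp
  | zero => simp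
  | add x y _ _ hx hy =>
    simp only [map_add, hx, hy, eval_add, add_mul]
    rw [intervalIntegral.integral_add (hint x) (hint y)]
    push_cast
    ring
  | smul r x _ hx =>
    rw [map_smul, ← algebraMap_smul ℂ r, map_smul, hx]
    simp only [eval_smul, smul_eq_mul, mul_assoc, intervalIntegral.integral_const_mul]
    simp
    ring

lemma norm_cfc_sub_cfc_le {A : Type*} [CStarAlgebra A] (a : A) [IsStarNormal a] {f g : ℂ → ℂ}
    (hf : ContinuousOn f (spectrum ℂ a)) (hg : ContinuousOn g (spectrum ℂ a)) {ε : ℝ}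
    (hε : 0 ≤ ε) (hfg : ∀ z ∈ spectrum ℂ a, ‖f z - g z‖ ≤ ε) : ‖cfc f a - cfc g a‖ ≤ ε := by
  rw [← cfc_sub f g a hf hg]
  exact norm_cfc_le hε hfg

lemma cfc_eq_add_I_smul {A : Type*} [CStarAlgebra A] (a : A) [IsStarNormal a] {f g k : ℂ → ℂ}
    (hf : ContinuousOn f (spectrum ℂ a)) (hg : ContinuousOn g (spectrum ℂ a))
    (hk : ∀ z, k z = f z + Complex.I * g z) : cfc k a = cfc f a + Complex.I • cfc g a := by
  rw [← cfc_smul Complex.I g a hg, ← cfc_add a f (fun x => Complex.I • g x) hf (hg.const_smul Complex.I)]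
  exact cfc_congr fun z _ => hk z

theorem IsHaar.apply_cfc_ofReal (hh : IsHaar q h) (hq0 : 0 < q) (hq1 : q < 1) {p : ℝ → ℝ}
    (hp : ContinuousOn p (Set.Icc (-1) 1)) :
    h (cfc (fun z : ℂ => (p z.re : ℂ)) (ρ q)) =
      ((2 / Real.pi * ∫ x in (-1 : ℝ)..1, p x * √(1 - x ^ 2) : ℝ) : ℂ) := by
  have hnormal := (isSelfAdjoint_ρ q).isStarNormal
  rw [← sub_eq_zero, ← norm_le_zero_iff]
  -- Replacing p by a polynomial within ε costs ‖h‖ε under h, and (2/π) · 2ε in the integral, the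
  -- interval having length 2 and the weight being at most 1.
  have hbound : ∀ ε : ℝ, 0 < ε → ‖h (cfc (fun z : ℂ => (p z.re : ℂ)) (ρ q)) -
      ((2 / Real.pi * ∫ x in (-1 : ℝ)..1, p x * √(1 - x ^ 2) : ℝ) : ℂ)‖ ≤
      (‖h‖ + 2 / Real.pi * 2) * ε := by
    intro ε hε
    obtain ⟨P, hP⟩ := exists_polynomial_near_of_continuousOn (-1) 1 p hp ε hε
    have h1 : ‖h (cfc (fun z : ℂ => (p z.re : ℂ)) (ρ q)) - h (aeval (ρ q) P)‖ ≤ ‖h‖ * ε := by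
      have c1 : ContinuousOn (fun z : ℂ => (p z.re : ℂ)) (spectrum ℂ (ρ q)) :=
        continuousOn_comp_re (p := fun x => (p x : ℂ))
          (Complex.continuous_ofReal.comp_continuousOn hp)
      have c2 : ContinuousOn (fun z : ℂ => ((P.eval z.re : ℝ) : ℂ)) (spectrum ℂ (ρ q)) :=
        Continuous.continuousOn (by fun_prop)
      rw [← map_sub, ← cfc_eval_re]
      refine (h.le_opNorm _).trans (mul_le_mul_of_nonneg_left ?_ (norm_nonneg _))
      refine norm_cfc_sub_cfc_le (ρ q) c1 c2 hε.le fun z hz => ?_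
      rw [← Complex.ofReal_sub, Complex.norm_real, Real.norm_eq_abs, abs_sub_comm]
      exact (hP _ (exists_ofReal_of_mem_spectrum_ρ hz).1).le
    have h2 : |(∫ x in (-1 : ℝ)..1, P.eval x * √(1 - x ^ 2)) -
        ∫ x in (-1 : ℝ)..1, p x * √(1 - x ^ 2)| ≤ ε * 2 := by
      rw [← intervalIntegral.integral_sub (Continuous.intervalIntegrable (by fun_prop) _ _)
        (ContinuousOn.intervalIntegrable (by
          rw [Set.uIcc_of_le (by norm_num)]
          exact hp.mul (Continuous.continuousOn (by fun_prop))))]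
      have h3 : ε * |(1 : ℝ) - -1| ≤ ε * 2 := by norm_num
      rw [← Real.norm_eq_abs]
      refine le_trans (intervalIntegral.norm_integral_le_of_norm_le_const fun x hx => ?_) h3
      rw [Set.uIoc_of_le (by norm_num)] at hx
      rw [← sub_mul, norm_mul, Real.norm_eq_abs, Real.norm_eq_abs,
        abs_of_nonneg (Real.sqrt_nonneg _)]
      refine (mul_le_of_le_one_right (abs_nonneg _) ?_).trans (hP x ⟨hx.1.le, hx.2⟩).le
      exact (Real.sqrt_le_sqrt (y := 1) (by nlinarith [sq_nonneg x])).trans Real.sqrt_one.le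
    calc _ ≤ ‖h (cfc (fun z : ℂ => (p z.re : ℂ)) (ρ q)) - h (aeval (ρ q) P)‖ +
          ‖h (aeval (ρ q) P) -
            ((2 / Real.pi * ∫ x in (-1 : ℝ)..1, p x * √(1 - x ^ 2) : ℝ) : ℂ)‖ :=
          norm_sub_le_norm_sub_add_norm_sub _ _ _
      _ ≤ ‖h‖ * ε + 2 / Real.pi * (ε * 2) := by
          refine add_le_add h1 ?_
          rw [hh.apply_aeval_ρ hq0 hq1, ← Complex.ofReal_sub, Complex.norm_real, ← mul_sub,
            norm_mul, Real.norm_eq_abs, Real.norm_eq_abs,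
            abs_of_pos (div_pos two_pos Real.pi_pos)]
          exact mul_le_mul_of_nonneg_left h2 (div_pos two_pos Real.pi_pos).le
      _ = _ := by ring
  refine le_of_forall_pos_le_add fun ε hε => ?_
  have hK : 0 < ‖h‖ + 2 / Real.pi * 2 := by have := Real.pi_pos; positivity
  refine (hbound (ε / (‖h‖ + 2 / Real.pi * 2)) (by positivity)).trans ?_
  rw [mul_div_cancel₀ _ hK.ne', zero_add]

theorem IsHaar.apply_cfc (hh : IsHaar q h) (hq0 : 0 < q) (hq1 : q < 1) {p : ℝ → ℂ}
    (hp : ContinuousOn p (Set.Icc (-1) 1)) :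
    h (cfc (fun z : ℂ => p z.re) (ρ q)) =
      (2 / Real.pi : ℂ) * ∫ x in (-1 : ℝ)..1, p x * (√(1 - x ^ 2) : ℂ) := by
  have hnormal := (isSelfAdjoint_ρ q).isStarNormal
  have hre : ContinuousOn (fun x => (p x).re) (Set.Icc (-1) 1) :=
    Complex.continuous_re.comp_continuousOn hp
  have him : ContinuousOn (fun x => (p x).im) (Set.Icc (-1) 1) :=
    Complex.continuous_im.comp_continuousOn hp
  have hsplit : cfc (fun z : ℂ => p z.re) (ρ q) =
      cfc (fun z : ℂ => ((p z.re).re : ℂ)) (ρ q) +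
        Complex.I • cfc (fun z : ℂ => ((p z.re).im : ℂ)) (ρ q) := by
    have c1 : ContinuousOn (fun z : ℂ => ((p z.re).re : ℂ)) (spectrum ℂ (ρ q)) :=
      continuousOn_comp_re (p := fun x => ((p x).re : ℂ))
        (Complex.continuous_ofReal.comp_continuousOn hre)
    have c2 : ContinuousOn (fun z : ℂ => ((p z.re).im : ℂ)) (spectrum ℂ (ρ q)) :=
      continuousOn_comp_re (p := fun x => ((p x).im : ℂ))
        (Complex.continuous_ofReal.comp_continuousOn him)
    refine cfc_eq_add_I_smul (ρ q) c1 c2 fun z => ?_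
    rw [mul_comm, Complex.re_add_im]
  have hint : ∀ f : ℝ → ℝ, ContinuousOn f (Set.Icc (-1) 1) →
      IntervalIntegrable (fun x => ((f x * √(1 - x ^ 2) : ℝ) : ℂ)) MeasureTheory.volume (-1) 1 := by
    intro f hf
    refine ContinuousOn.intervalIntegrable ?_
    rw [Set.uIcc_of_le (by norm_num)]
    exact Complex.continuous_ofReal.comp_continuousOn
      (hf.mul (Continuous.continuousOn (by fun_prop)))
  have hsplit' : ∫ x in (-1 : ℝ)..1, p x * (√(1 - x ^ 2) : ℂ) =
      ((∫ x in (-1 : ℝ)..1, (p x).re * √(1 - x ^ 2) : ℝ) : ℂ) +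
        Complex.I * ((∫ x in (-1 : ℝ)..1, (p x).im * √(1 - x ^ 2) : ℝ) : ℂ) := by
    rw [← intervalIntegral.integral_ofReal, ← intervalIntegral.integral_ofReal,
      ← intervalIntegral.integral_const_mul, ← intervalIntegral.integral_add (hint _ hre)
        ((hint _ him).const_mul _)]
    refine intervalIntegral.integral_congr fun x _ => ?_
    conv_lhs => rw [← Complex.re_add_im (p x)]
    push_cast
    ring
  rw [hsplit, map_add, map_smul, hh.apply_cfc_ofReal hq0 hq1 hre,
    hh.apply_cfc_ofReal hq0 hq1 him, hsplit', smul_eq_mul]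
  push_cast
  ring

lemma elemental_eq_range_cfc (q : ℝ) :
    (StarAlgebra.elemental ℂ (α q + star (α q)) : Set (SUq q)) =
      {x | ∃ p : ℝ → ℂ, ContinuousOn p (Set.Icc (-1) 1) ∧
        x = cfc (fun z : ℂ => p z.re) (ρ q)} := by
  have hnormal := (isSelfAdjoint_ρ q).isStarNormal
  have hel : StarAlgebra.elemental ℂ (α q + star (α q)) = StarAlgebra.elemental ℂ (ρ q) := by
    apply le_antisymm
    · refine StarAlgebra.elemental.le_of_mem (StarAlgebra.elemental.isClosed ℂ _) ?_
      have : α q + star (α q) = (2 : ℂ) • ρ q := by rw [ρ, smul_smul]; norm_num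
      rw [this]
      exact SMulMemClass.smul_mem _ (StarAlgebra.elemental.self_mem ℂ _)
    · refine StarAlgebra.elemental.le_of_mem (StarAlgebra.elemental.isClosed ℂ _) ?_
      exact SMulMemClass.smul_mem _ (StarAlgebra.elemental.self_mem ℂ _)
  rw [hel]
  ext x
  constructor
  · intro hx
    rw [← range_cfcHom ℂ hnormal] at hx
    obtain ⟨f, rfl⟩ := hx
    -- Tietze extension from the spectrum to ℂ; the restriction of `g` to the real line serves as
    -- `p`.
    obtain ⟨g, hg⟩ := ContinuousMap.exists_restrict_eq (spectrum.isClosed (𝕜 := ℂ) (ρ q)) f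
    refine ⟨fun x => g x, by fun_prop, ?_⟩
    have h1 : cfc (fun z : ℂ => g z.re) (ρ q) = cfc g (ρ q) := cfc_congr fun z hz => by
      rw [← (exists_ofReal_of_mem_spectrum_ρ hz).2]
    rw [h1, cfc_apply g (ρ q)]
    change cfcHom _ f = _
    rw [← hg]
    rfl
  · rintro ⟨p, -, rfl⟩
    rw [← range_cfc ℂ hnormal]
    exact ⟨_, rfl⟩

end Moments

end QuantumSU2

end

theorem theorem4p1 (q : ℝ) (hq0 : 0 < q) (hq1 : q < 1) (h : QuantumSU2.SUq q →L[ℂ] ℂ)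
    (hh : QuantumSU2.IsHaar q h) :
    IsSelfAdjoint (QuantumSU2.ρ q) ∧
    spectrum ℝ (QuantumSU2.ρ q) ⊆ Set.Icc (-1) 1 ∧
    (StarAlgebra.elemental ℂ (QuantumSU2.α q + star (QuantumSU2.α q)) : Set (QuantumSU2.SUq q)) =
      {x | ∃ p : ℝ → ℂ, ContinuousOn p (Set.Icc (-1) 1) ∧
        x = cfc (fun z : ℂ => p z.re) (QuantumSU2.ρ q)} ∧
    ∀ p : ℝ → ℂ, ContinuousOn p (Set.Icc (-1) 1) →
      h (cfc (fun z : ℂ => p z.re) (QuantumSU2.ρ q)) =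
        (2 / Real.pi : ℂ) * ∫ x in (-1 : ℝ)..1, p x * (Real.sqrt (1 - x ^ 2) : ℂ) := by
  exact ⟨QuantumSU2.isSelfAdjoint_ρ q, QuantumSU2.spectrum_ρ_subset q,
    QuantumSU2.elemental_eq_range_cfc q, fun _ hp => hh.apply_cfc hq0 hq1 hp⟩
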